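/- Let $G$ be a locally compact second countable group. A $G$-space $(X,\nu)$ is a standard Borel space $X$ with an action of $G$ by measurable maps and a probability measure $\nu$ whose class of null sets is preserved by the action; write $g\nu(E)=\nu(g^{-1}E)$. A $G$-map $\pi:(X,\nu)\to(Y,\eta)$ of $G$-spaces is a measurable map with $\pi_*\nu=\eta$ such that, for every $g\in G$, $\pi(gx)=g\pi(x)$ for $\nu$-almost every $x$. Its disintegration is the ($\eta$-almost everywhere unique) measurable map $D_\pi$ from $Y$ to the probability measures on $X$ such that $D_\pi(y)$ is carried by $\pi^{-1}(y)$ for almost every $y$ and $\int_Y D_\pi(y)\,d\eta(y)=\nu$; $\pi$ is relatively measure-preserving if, for every $g\in G$, $D_\pi(gy)=gD_\pi(y)$ for $\eta$-almost every $y$. The $G$-space $(X,\nu)$ is contractive if $\sup_{g\in G}\nu(gB)=1$ for every measurable $B\subseteq X$ with $\nu(B)>0$. A joining of $(X,\nu)$ and $(Y,\eta')$ is a probability measure on $X\times Y$ with marginals $\nu$ and $\eta'$ that is quasi-invariant under the diagonal $G$-action. Theorem. Let $(X,\nu)$ be a contractive $G$-space and let $\pi:(X,\nu)\to(Y,\eta)$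 be a $G$-map of $G$-spaces. Let $\eta'$ be a probability measure on $Y$ with $\eta'\ll\eta$ such that $(Y,\eta')$ is a $G$-space, and let $\zeta$ be a joining of $(X,\nu)$ and $(Y,\eta')$ such that the projection $(X\times Y,\zeta)\to(X,\nu)$ is relatively measure-preserving. Then $\zeta=\tilde\pi_*\nu$, where $\tilde\pi(x)=(x,\pi(x))$, and in particular $\eta'=\eta$. -/

import Mathlib

open MeasureTheory ProbabilityTheory
open scoped Pointwise

/-- `(X, ν)` is a `G`-space (for `X` a standard Borel space with an action of `G`): `ν` is a
probability measure, every `g : G` acts by a measurable map, and the action preserves the class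
of `ν`-null sets. Joint measurability of `G × X → X` is not required, so this includes all Borel
actions of topological groups. -/
structure IsGSpace (G : Type*) {X : Type*} [Group G] [MulAction G X] [MeasurableSpace X]
    (ν : Measure X) : Prop where
  isProbabilityMeasure : IsProbabilityMeasure ν
  measurable_smul : ∀ g : G, Measurable (fun x : X => g • x)
  quasiInvariant : ∀ (g : G) (E : Set X), MeasurableSet E → (ν (g • E) = 0 ↔ ν E = 0)

/-- `π` is a `G`-map `(X, ν) → (Y, η)`: it is measurable, it pushes `ν` forward to `η`, and for
every `g` it satisfies `π (g x) = g π x` for almost every `x`. -/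
structure IsGMap (G : Type*) {X Y : Type*} [Group G] [MulAction G X] [MulAction G Y]
    [MeasurableSpace X] [MeasurableSpace Y] (π : X → Y) (ν : Measure X) (η : Measure Y) :
    Prop where
  measurable : Measurable π
  map_eq : ν.map π = η
  equivariant : ∀ g : G, ∀ᵐ x ∂ν, π (g • x) = g • π x

/-- The action of `G` on `(X, ν)` is contractive: `sup_g ν(gB) = 1` for every measurable set `B`
of positive measure. -/
def IsContractive (G : Type*) {X : Type*} [Group G] [MulAction G X] [MeasurableSpace X]
    (ν : Measure X) : Prop :=
  ∀ B : Set X, MeasurableSet B → 0 < ν B → ⨆ g : G, ν (g • B) = 1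

/-- The measurable family of probability measures `D y` is the disintegration of `ν` over `η`
via `π`: almost every `D y` is carried by the fibre `π⁻¹(y)`, and `∫ D y dη(y) = ν`. -/
structure IsDisintegration {X Y : Type*} [MeasurableSpace X] [MeasurableSpace Y]
    (π : X → Y) (ν : Measure X) (η : Measure Y) (D : Kernel Y X) : Prop where
  isMarkovKernel : IsMarkovKernel D
  ae_fibre : ∀ᵐ y ∂η, D y (π ⁻¹' {y})ᶜ = 0
  bind_eq : η.bind D = ν

/-- `π : (X, ν) → (Y, η)` is relatively measure-preserving: the disintegration `D` of `ν` over
`η` via `π` is equivariant, i.e. for every `g` one has `D (g y) = g D y` for almost every `y`. -/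
def IsRelativelyMeasurePreserving (G : Type*) {X Y : Type*} [Group G] [MulAction G X]
    [MulAction G Y] [MeasurableSpace X] [MeasurableSpace Y] (π : X → Y) (ν : Measure X)
    (η : Measure Y) : Prop :=
  ∃ D : Kernel Y X, IsDisintegration π ν η D ∧
    ∀ g : G, ∀ᵐ y ∂η, D (g • y) = (D y).map (fun x => g • x)

/-- `α` is a joining of the `G`-spaces `(X, ν)` and `(Y, η)`: a probability measure on `X × Y`
with marginals `ν` and `η` that is quasi-invariant under the diagonal action of `G`. -/
structure IsJoining (G : Type*) {X Y : Type*} [Group G] [MulAction G X] [MulAction G Y]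
    [MeasurableSpace X] [MeasurableSpace Y] (ν : Measure X) (η : Measure Y)
    (α : Measure (X × Y)) : Prop where
  isGSpace : IsGSpace G α
  map_fst : α.map Prod.fst = ν
  map_snd : α.map Prod.snd = η

/-! Contractivity forces the fibre over `x` to sit at `π x`. If fibres over a positive-measure set
`B ⊆ π ⁻¹' A` gave `Aᶜ` mass at least `c`, then by equivariance those over `g • B` give `(g • A)ᶜ`
mass at least `c`, so `η' (g • A)ᶜ ≥ c * ν (g • B)`. As `ν (g • B)` tends to one, `η (g • A)ᶜ ≤ ν (g
• B)ᶜ` tends to zero, against `η' ≪ η`. Countably many sets `A` separate points of `Y`, so `ζ` lives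
on the graph of `π`. -/

/-- Uniform form of absolute continuity for a finite measure. -/
theorem exists_pos_measure_lt_of_absolutelyContinuous {Y : Type*} [MeasurableSpace Y]
    {η η' : Measure Y} [IsFiniteMeasure η] [IsFiniteMeasure η'] (hac : η' ≪ η)
    {ε : ENNReal} (hε : ε ≠ 0) :
    ∃ δ > 0, ∀ s : Set Y, η s < δ → η' s < ε := by
  obtain ⟨δ, hδ, h⟩ := exists_pos_setLIntegral_lt_of_measure_lt (μ := η)
    (f := η'.rnDeriv η) (Measure.lintegral_rnDeriv_lt_top η' η).ne hε
  refine ⟨δ, hδ, fun s hs => ?_⟩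
  rw [← Measure.setLIntegral_rnDeriv hac s]
  exact h s hs

theorem IsGSpace.measurableSet_smul {G X : Type*} [Group G] [MulAction G X] [MeasurableSpace X]
    {ν : Measure X} (hν : IsGSpace G ν) (g : G) {B : Set X} (hB : MeasurableSet B) :
    MeasurableSet (g • B) := by
  rw [← Set.preimage_smul_inv]
  exact hν.measurable_smul g⁻¹ hB

/-- In a contractive space, translates of a set of positive measure have measure arbitrarily
close to one, so their complements are arbitrarily small. -/
theorem IsContractive.exists_smul {G X : Type*} [Group G] [MulAction G X] [MeasurableSpace X]
    {ν : Measure X} (hν : IsGSpace G ν) (hc : IsContractive G ν) {B : Set X}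
    (hB : MeasurableSet B) (hpos : 0 < ν B) {ε : ENNReal} (hε : 0 < ε) :
    ∃ g : G, (1 / 2 : ENNReal) < ν (g • B) ∧ ν (g • B)ᶜ < ε := by
  have := hν.isProbabilityMeasure
  have hlt : max (1 / 2) (1 - ε) < ⨆ g : G, ν (g • B) := by
    rw [hc B hB hpos]
    exact max_lt (by simp) (ENNReal.sub_lt_self ENNReal.one_ne_top one_ne_zero hε.ne')
  obtain ⟨g, hg⟩ := lt_iSup_iff.1 hlt
  obtain ⟨hhalf, hsub⟩ := max_lt_iff.1 hg
  refine ⟨g, hhalf, ?_⟩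
  rw [prob_compl_eq_one_sub (hν.measurableSet_smul g hB)]
  exact ENNReal.sub_lt_of_sub_lt prob_le_one (Or.inl ENNReal.one_ne_top) hsub

/-- The fibre measures over `π ⁻¹' A` do not charge `Aᶜ` in the second coordinate. -/
theorem ae_disintegration_snd_compl_eq_zero {G X Y : Type*} [Group G]
    [MeasurableSpace X] [MulAction G X] [MeasurableSpace Y] [MulAction G Y]
    {ν : Measure X} (hν : IsGSpace G ν) (hcontr : IsContractive G ν)
    {η : Measure Y} (hη : IsGSpace G η) {π : X → Y} (hπ : IsGMap G π ν η)
    {η' : Measure Y} (hη' : IsGSpace G η') (hac : η' ≪ η)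
    {ζ : Measure (X × Y)} (hζ : IsJoining G ν η' ζ) {D : Kernel X (X × Y)}
    (hD : IsDisintegration Prod.fst ζ ν D)
    (hDG : ∀ g : G, ∀ᵐ x ∂ν, D (g • x) = (D x).map (fun z => g • z))
    {A : Set Y} (hA : MeasurableSet A) :
    ∀ᵐ x ∂ν, π x ∈ A → D x (Prod.snd ⁻¹' Aᶜ) = 0 := by
  have := hν.isProbabilityMeasure
  have := hη.isProbabilityMeasure
  have := hη'.isProbabilityMeasure
  have hS : MeasurableSet (Prod.snd ⁻¹' Aᶜ : Set (X × Y)) := measurable_snd hA.compl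
  have hnull (c : ENNReal) (hc : c ≠ 0) :
      ν {x | π x ∈ A ∧ c ≤ D x (Prod.snd ⁻¹' Aᶜ)} = 0 := by
    set B := {x | π x ∈ A ∧ c ≤ D x (Prod.snd ⁻¹' Aᶜ)} with hBdef
    have hB : MeasurableSet B := (hπ.measurable hA).inter
      (measurableSet_le measurable_const (D.measurable_coe hS))
    by_contra hpos
    -- The threshold `c / 2` is what fibre mass `c` over a set of measure above `1 / 2` contradicts.
    obtain ⟨δ, hδ, hsmall⟩ := exists_pos_measure_lt_of_absolutelyContinuous hac
      (ε := c * (1 / 2)) (by simp [hc])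
    obtain ⟨g, hhalf, hcompl⟩ := hcontr.exists_smul hν hB (pos_iff_ne_zero.2 hpos) hδ
    have hgA : MeasurableSet (g • A) := hη.measurableSet_smul g hA
    have hgS : MeasurableSet (Prod.snd ⁻¹' (g • A)ᶜ : Set (X × Y)) := measurable_snd hgA.compl
    have hηsmall : η (g • A)ᶜ < δ := by
      refine lt_of_le_of_lt ?_ hcompl
      -- Up to a null set, `π` maps `g • B` into `g • A`.
      rw [← hπ.map_eq, Measure.map_apply hπ.measurable hgA.compl]
      refine measure_mono_ae ?_
      filter_upwards [hπ.equivariant g⁻¹] with x hx hxA hxB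
      apply hxA
      rw [Set.mem_smul_set_iff_inv_smul_mem] at hxB ⊢
      rw [← hx]
      exact hxB.1
    refine (hsmall _ hηsmall).not_ge ?_
    calc c * (1 / 2) ≤ c * ν (g • B) := by gcongr
      _ = ∫⁻ _ in g • B, c ∂ν := by simp
      _ ≤ ∫⁻ x in g • B, D x (Prod.snd ⁻¹' (g • A)ᶜ) ∂ν := by
        refine setLIntegral_mono_ae (D.measurable_coe hgS).aemeasurable ?_
        -- Equivariance at `g⁻¹` carries the bound from `g⁻¹ • x ∈ B` to `x`.
        filter_upwards [hDG g⁻¹] with x hx hxB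
        rw [Set.mem_smul_set_iff_inv_smul_mem] at hxB
        have h := hxB.2
        rw [hx, Measure.map_apply (hζ.isGSpace.measurable_smul g⁻¹) hS] at h
        convert h using 2
        ext z
        simp [Set.mem_smul_set_iff_inv_smul_mem]
      _ ≤ ∫⁻ x, D x (Prod.snd ⁻¹' (g • A)ᶜ) ∂ν := setLIntegral_le_lintegral _ _
      _ = η' (g • A)ᶜ := by
        rw [← Measure.bind_apply hgS D.aemeasurable, hD.bind_eq,
          ← Measure.map_apply measurable_snd hgA.compl, hζ.map_snd]
  have hall : ∀ᵐ x ∂ν, ∀ n : ℕ, ¬(π x ∈ A ∧ (n : ENNReal)⁻¹ ≤ D x (Prod.snd ⁻¹' Aᶜ)) :=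
    ae_all_iff.2 fun n => by simpa [ae_iff] using hnull (n : ENNReal)⁻¹ (by simp)
  filter_upwards [hall] with x hx hxA
  by_contra h
  obtain ⟨n, hn⟩ := ENNReal.exists_inv_nat_lt h
  exact hx n ⟨hxA, hn.le⟩

theorem theoremT {G : Type*} [Group G] [TopologicalSpace G] [IsTopologicalGroup G]
    [LocallyCompactSpace G] [SecondCountableTopology G]
    {X Y : Type*} [MeasurableSpace X] [StandardBorelSpace X] [MulAction G X]
    [MeasurableSpace Y] [StandardBorelSpace Y] [MulAction G Y]
    (ν : Measure X) (hν : IsGSpace G ν) (hcontr : IsContractive G ν)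
    (η : Measure Y) (hη : IsGSpace G η)
    (π : X → Y) (hπ : IsGMap G π ν η)
    (η' : Measure Y) (hη' : IsGSpace G η') (hac : η' ≪ η)
    (ζ : Measure (X × Y)) (hζ : IsJoining G ν η' ζ)
    (hrel : IsRelativelyMeasurePreserving G (Prod.fst : X × Y → X) ζ ν) :
    ζ = ν.map (fun x => (x, π x)) ∧ η' = η := by
  obtain ⟨D, hD, hDG⟩ := hrel
  have hgraph : Measurable fun x => (x, π x) := measurable_id.prodMk hπ.measurable
  have key {A : Set Y} (hA : MeasurableSet A) : ∀ᵐ z ∂ζ, π z.1 ∈ A → z.2 ∈ A := by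
    have hM : MeasurableSet ((fun z : X × Y => π z.1) ⁻¹' A ∩ Prod.snd ⁻¹' Aᶜ) :=
      (hπ.measurable.comp measurable_fst hA).inter (measurable_snd hA.compl)
    have hzero : ζ ((fun z : X × Y => π z.1) ⁻¹' A ∩ Prod.snd ⁻¹' Aᶜ) = 0 := by
      rw [← hD.bind_eq, Measure.bind_apply hM D.aemeasurable,
        lintegral_eq_zero_iff (D.measurable_coe hM)]
      filter_upwards [hD.ae_fibre,
        ae_disintegration_snd_compl_eq_zero hν hcontr hη hπ hη' hac hζ hD hDG hA] with x hfib hx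
      by_cases hxA : π x ∈ A
      · exact measure_mono_null Set.inter_subset_right (hx hxA)
      -- The fibre over `x` lies in `{x} × Y`, so it misses `π ⁻¹' A × Aᶜ`.
      · refine measure_mono_null ?_ hfib
        rintro z ⟨hz, -⟩ rfl
        exact hxA hz
    rw [ae_iff]
    convert hzero using 2
    ext z
    simp
  have hsnd : (fun z : X × Y => z.2) =ᵐ[ζ] fun z => π z.1 := by
    refine Filter.EventuallyEq.of_forall_separating_mem_iff MeasurableSet fun A hA => ?_
    -- The complement supplies the converse implication.
    filter_upwards [key hA, key hA.compl] with z h h'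
    exact ⟨fun hz => by_contra fun hn => h' hn hz, h⟩
  have hζeq : ζ = ν.map (fun x => (x, π x)) := by
    rw [← hζ.map_fst, Measure.map_map hgraph measurable_fst]
    conv_lhs => rw [← Measure.map_id (μ := ζ)]
    refine Measure.map_congr ?_
    filter_upwards [hsnd] with z hz
    exact Prod.ext rfl hz
  refine ⟨hζeq, ?_⟩
  rw [← hζ.map_snd, hζeq, Measure.map_map measurable_snd hgraph, ← hπ.map_eq]
  rfl
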